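/- Let $\mathbb{R}^{1,4}$ carry the scalar product $\ell\cdot\ell'=-\ell^0\ell'^0+\sum_{i=1}^4\ell^i\ell'^i$, and let $C=\{\ell\in\mathbb{R}^{1,4} : \ell\cdot\ell=0,\ \ell^0>0\}$ be the future light cone, whose rays form the asymptotic $3$-sphere $\mathcal{I}$. Let $\Delta\in\mathbb{R}$. The space $V_\Delta$ of boundary data of conformal weight $\Delta$ on $\mathcal{I}$ is the real vector space of smooth functions $f:C\to\mathbb{R}$ with $f(\lambda\ell)=\lambda^{-\Delta}f(\ell)$ for all $\lambda>0$ and $\ell\in C$, with its usual $C^\infty$ topology (uniform convergence of all derivatives on compact sets). A symplectic form on $V_\Delta$ is a continuous bilinear map $\Omega:V_\Delta\times V_\Delta\to\mathbb{R}$ that is antisymmetric, $\Omega(f_1,f_2)=-\Omega(f_2,f_1)$, and (weakly) nondegenerate: if $\Omega(f_1,f_2)=0$ for all $f_2\in V_\Delta$, then $f_1=0$. The group $SO^+(4,1)$ of those elements of $SO(4,1)$ that map $C$ to itself (its identity component) acts on $V_\Delta$ by $(g f)(\ell)=f(g^{-1}\ell)$. Theorem. For no $\Delta\in\mathbb{R}$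 is there a symplectic form $\Omega$ on $V_\Delta$ that is invariant under $SO^+(4,1)$, i.e. satisfies $\Omega(g f_1,g f_2)=\Omega(f_1,f_2)$ for all $g\in SO^+(4,1)$ and $f_1,f_2\in V_\Delta$. A fortiori, there is none that is invariant under the full de Sitter group $SO(4,1)$. -/

import Mathlib

open scoped ContDiff

noncomputable section

namespace DeSitter

/-- The vector space `ℝ^{1,4}`; the coordinate `0` is the time coordinate. -/
abbrev Mink : Type := Fin 5 → ℝ

/-- The Minkowski scalar product of signature `(-,+,+,+,+)`. -/
def dot (x y : Mink) : ℝ := -(x 0 * y 0) + ∑ i : Fin 4, x i.succ * y i.succ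

/-- The future light cone without its vertex: the future-pointing null vectors. -/
def FutureCone : Set Mink := {ℓ | dot ℓ ℓ = 0 ∧ 0 < ℓ 0}

lemma smul_mem_futureCone {c : ℝ} (hc : 0 < c) {ℓ : Mink} (hℓ : ℓ ∈ FutureCone) :
    c • ℓ ∈ FutureCone := by
  obtain ⟨h, h0⟩ := hℓ
  refine ⟨?_, by simpa using mul_pos hc h0⟩
  have : dot (c • ℓ) (c • ℓ) = c ^ 2 * dot ℓ ℓ := by
    simp only [dot, Pi.smul_apply, smul_eq_mul, mul_add, Finset.mul_sum]
    congr 1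
    · ring
    · exact Finset.sum_congr rfl fun i _ => by ring
  rw [this, h, mul_zero]

/-- The special orthogonal group `SO(4,1)` of the Minkowski scalar product. -/
def SO41 : Subgroup (Matrix.SpecialLinearGroup (Fin 5) ℝ) where
  carrier := {g | ∀ x y : Mink, dot (g.1.mulVec x) (g.1.mulVec y) = dot x y}
  one_mem' := by intro x y; simp
  mul_mem' := by
    intro a b ha hb x y
    have := (ha (b.1.mulVec x) (b.1.mulVec y)).trans (hb x y)
    simpa [Matrix.mulVec_mulVec] using this
  inv_mem' := by
    intro a ha x y
    have key : ∀ v : Mink, a.1.mulVec ((a⁻¹).1.mulVec v) = v := fun v => by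
      have h : a.1 * (a⁻¹).1 = 1 := by
        rw [← Matrix.SpecialLinearGroup.coe_mul, mul_inv_cancel, Matrix.SpecialLinearGroup.coe_one]
      rw [Matrix.mulVec_mulVec, h, Matrix.one_mulVec]
    have := ha ((a⁻¹).1.mulVec x) ((a⁻¹).1.mulVec y)
    rw [key, key] at this
    exact this.symm

/-- The identity component `SO⁺(4,1)` of `SO(4,1)`: the elements of `SO(4,1)` that map the future
light cone (rather than the past one) onto the future light cone. -/
def SOPlus41 : Subgroup SO41 where
  carrier := {g | ∀ ℓ : Mink, g.1.1.mulVec ℓ ∈ FutureCone ↔ ℓ ∈ FutureCone}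
  one_mem' := by intro ℓ; simp
  mul_mem' := by
    intro a b ha hb ℓ
    have := (ha (b.1.1.mulVec ℓ)).trans (hb ℓ)
    simpa [Matrix.mulVec_mulVec] using this
  inv_mem' := by
    intro a ha ℓ
    have key : a.1.1.mulVec ((a⁻¹).1.1.mulVec ℓ) = ℓ := by
      have h : a.1.1 * (a⁻¹).1.1 = 1 := by
        rw [← Matrix.SpecialLinearGroup.coe_mul, ← Subgroup.coe_mul, mul_inv_cancel]
        simp
      rw [Matrix.mulVec_mulVec, h, Matrix.one_mulVec]
    have := ha ((a⁻¹).1.1.mulVec ℓ)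
    rw [key] at this
    exact this.symm

/-- The action of `SO⁺(4,1)` on the future light cone. -/
def moveCone (g : SOPlus41) (ℓ : FutureCone) : FutureCone :=
  ⟨g.1.1.1.mulVec ℓ.1, (g.2 ℓ.1).2 ℓ.2⟩

lemma moveCone_one (ℓ : FutureCone) : moveCone 1 ℓ = ℓ := by
  apply Subtype.ext
  simp [moveCone]

lemma moveCone_mul (g h : SOPlus41) (ℓ : FutureCone) :
    moveCone (g * h) ℓ = moveCone g (moveCone h ℓ) := by
  apply Subtype.ext
  simp [moveCone, Matrix.mulVec_mulVec]

/-- The Euclidean space `ℝ⁴` of spatial coordinates. -/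
abbrev Space : Type := EuclideanSpace ℝ (Fin 4)

/-- The global parametrization `x ↦ (‖x‖, x)` of the future light cone by `ℝ⁴ ∖ {0}`. -/
def lightVec (x : Space) : Mink := Fin.cons ‖x‖ x.ofLp

/-- The spatial part of a vector of `ℝ^{1,4}`. -/
def spatial (ℓ : Mink) : Space := WithLp.toLp 2 fun i => ℓ i.succ

lemma lightVec_mem {x : Space} (hx : x ≠ 0) : lightVec x ∈ FutureCone := by
  refine ⟨?_, by simpa [lightVec] using hx⟩
  have h := EuclideanSpace.real_norm_sq_eq x
  simp only [dot, lightVec, Fin.cons_zero, Fin.cons_succ]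
  have h2 : ∑ i, x.ofLp i * x.ofLp i = ‖x‖ ^ 2 := by
    rw [h]
    exact Finset.sum_congr rfl fun i _ => by ring
  rw [h2]
  ring

lemma norm_spatial {ℓ : Mink} (hℓ : ℓ ∈ FutureCone) : ‖spatial ℓ‖ = ℓ 0 := by
  obtain ⟨h, h0⟩ := hℓ
  have h1 : ‖spatial ℓ‖ ^ 2 = ℓ 0 ^ 2 := by
    rw [EuclideanSpace.real_norm_sq_eq]
    have : ∑ i : Fin 4, ℓ i.succ * ℓ i.succ = ℓ 0 ^ 2 := by
      unfold dot at h
      linarith [sq (ℓ 0)]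
    rw [← this]
    exact Finset.sum_congr rfl fun i _ => by simp [spatial, sq]
  exact (pow_left_inj₀ (norm_nonneg _) h0.le two_ne_zero).1 h1

lemma spatial_ne_zero {ℓ : Mink} (hℓ : ℓ ∈ FutureCone) : spatial ℓ ≠ 0 := by
  rw [← norm_pos_iff, norm_spatial hℓ]
  exact hℓ.2

lemma lightVec_spatial {ℓ : Mink} (hℓ : ℓ ∈ FutureCone) : lightVec (spatial ℓ) = ℓ := by
  funext i
  refine Fin.cases ?_ (fun j => ?_) i
  · simpa [lightVec] using norm_spatial hℓ
  · simp [lightVec, spatial]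

open Classical in
/-- A function on the future light cone, read in the parametrization `x ↦ (‖x‖, x)`
(with the irrelevant value `0` at `x = 0`). -/
def inChart (f : FutureCone → ℝ) (x : Space) : ℝ :=
  if hx : x ≠ 0 then f ⟨lightVec x, lightVec_mem hx⟩ else 0

/-- `f` is a smooth function on the future light cone. -/
def IsSmooth (f : FutureCone → ℝ) : Prop := ContDiffOn ℝ ∞ (inChart f) {0}ᶜ

/-- `f` has conformal weight `Δ`: `f (c ℓ) = c ^ (-Δ) * f ℓ` for `c > 0`. -/
def HasWeight (Δ : ℝ) (f : FutureCone → ℝ) : Prop :=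
  ∀ (c : ℝ) (hc : 0 < c) (ℓ : FutureCone),
    f ⟨c • ℓ.1, smul_mem_futureCone hc ℓ.2⟩ = c ^ (-Δ) * f ℓ

lemma inChart_add (f g : FutureCone → ℝ) : inChart (f + g) = inChart f + inChart g := by
  funext x
  by_cases hx : x = 0 <;> simp [inChart, hx]

lemma inChart_smul (c : ℝ) (f : FutureCone → ℝ) : inChart (c • f) = c • inChart f := by
  funext x
  by_cases hx : x = 0 <;> simp [inChart, hx]

lemma inChart_zero : inChart 0 = 0 := by
  funext x
  by_cases hx : x = 0 <;> simp [inChart, hx]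

/-- The smooth real functions of conformal weight `Δ` on the future light cone, as a subspace of
all functions. -/
def boundarySubmodule (Δ : ℝ) : Submodule ℝ (FutureCone → ℝ) where
  carrier := {f | IsSmooth f ∧ HasWeight Δ f}
  add_mem' := by
    rintro f g ⟨hf, hf'⟩ ⟨hg, hg'⟩
    refine ⟨?_, fun c hc ℓ => ?_⟩
    · rw [IsSmooth, inChart_add]
      exact ContDiffOn.add hf hg
    · simp only [Pi.add_apply, hf' c hc ℓ, hg' c hc ℓ, mul_add]
  zero_mem' := by
    refine ⟨?_, fun c hc ℓ => by simp⟩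
    rw [IsSmooth, inChart_zero]
    exact contDiffOn_const
  smul_mem' := by
    rintro a f ⟨hf, hf'⟩
    refine ⟨?_, fun c hc ℓ => ?_⟩
    · rw [IsSmooth, inChart_smul]
      exact ContDiffOn.const_smul a hf
    · simp only [Pi.smul_apply, smul_eq_mul, hf' c hc ℓ]
      ring

/-- The real vector space of boundary data of conformal weight `Δ` on the projectivized future
light cone: the smooth real functions of conformal weight `Δ` on the cone. (A type of its own, so
that it does not carry the topology of pointwise convergence.) -/
def BoundaryData (Δ : ℝ) : Type := boundarySubmodule Δ

instance (Δ : ℝ) : AddCommGroup (BoundaryData Δ) :=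
  inferInstanceAs (AddCommGroup (boundarySubmodule Δ))

instance (Δ : ℝ) : Module ℝ (BoundaryData Δ) := inferInstanceAs (Module ℝ (boundarySubmodule Δ))

lemma isSmooth_comp_moveCone {f : FutureCone → ℝ} (hf : IsSmooth f) (g : SOPlus41) :
    IsSmooth fun ℓ => f (moveCone g ℓ) := by
  have hL : ContDiffOn ℝ ∞ lightVec {0}ᶜ := by
    refine contDiffOn_pi.2 fun i => ?_
    refine Fin.cases ?_ (fun j => ?_) i
    · simp only [lightVec, Fin.cons_zero]
      exact fun x hx => (contDiffAt_norm ℝ hx).contDiffWithinAt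
    · simp only [lightVec, Fin.cons_succ]
      fun_prop
  have hS : ContDiff ℝ ∞ spatial := by
    unfold spatial
    fun_prop
  have hM : ContDiff ℝ ∞ fun v : Mink => g.1.1.1.mulVec v :=
    (LinearMap.toContinuousLinearMap (Matrix.mulVecLin g.1.1.1)).contDiff
  have hc : ContDiffOn ℝ ∞ (fun x => spatial (g.1.1.1.mulVec (lightVec x))) {0}ᶜ :=
    (hS.comp hM).comp_contDiffOn hL
  have hm : Set.MapsTo (fun x => spatial (g.1.1.1.mulVec (lightVec x))) {0}ᶜ {0}ᶜ :=
    fun x hx => spatial_ne_zero ((g.2 _).2 (lightVec_mem hx))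
  refine (ContDiffOn.comp hf hc hm).congr fun x hx => ?_
  have hx' : x ≠ 0 := hx
  have hy : spatial (g.1.1.1.mulVec (lightVec x)) ≠ 0 := hm hx
  simp only [inChart, Function.comp, dif_pos hx', dif_pos hy]
  congr 1
  exact Subtype.ext (lightVec_spatial ((g.2 _).2 (lightVec_mem hx'))).symm

/-- The representation `(g · f)(ℓ) = f (g⁻¹ ℓ)` of `SO⁺(4,1)` on boundary data. -/
def boundaryRep (Δ : ℝ) : Representation ℝ SOPlus41 (BoundaryData Δ) where
  toFun g :=
    { toFun := fun f => ⟨fun ℓ => f.1 (moveCone g⁻¹ ℓ), isSmooth_comp_moveCone f.2.1 g⁻¹, by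
        intro c hc ℓ
        refine Eq.trans (congrArg f.1 ?_) (f.2.2 c hc (moveCone g⁻¹ ℓ))
        exact Subtype.ext (Matrix.mulVec_smul (g⁻¹).1.1.1 c ℓ.1)⟩
      map_add' := fun _ _ => rfl
      map_smul' := fun _ _ => rfl }
  map_one' := by
    refine LinearMap.ext fun f => Subtype.ext (funext fun ℓ => ?_)
    change f.1 (moveCone (1 : SOPlus41)⁻¹ ℓ) = f.1 ℓ
    rw [inv_one, moveCone_one]
  map_mul' g h := by
    refine LinearMap.ext fun f => Subtype.ext (funext fun ℓ => ?_)
    change f.1 (moveCone (g * h)⁻¹ ℓ) = f.1 (moveCone h⁻¹ (moveCone g⁻¹ ℓ))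
    rw [mul_inv_rev, moveCone_mul]

/-- The unit sphere of `ℝ⁴`, whose image under `x ↦ (‖x‖, x)` meets every ray of the cone once. -/
abbrev UnitSphere : Type := Metric.sphere (0 : Space) 1

lemma bddAbove_deriv {f : FutureCone → ℝ} (hf : IsSmooth f) (k : ℕ) :
    BddAbove (Set.range fun n : UnitSphere => ‖iteratedFDeriv ℝ k (inChart f) n‖) := by
  have ho : IsOpen ({0}ᶜ : Set Space) := isOpen_compl_singleton
  have h1 : ContinuousOn (iteratedFDeriv ℝ k (inChart f)) {0}ᶜ :=
    (hf.continuousOn_iteratedFDerivWithin (mod_cast le_top) ho.uniqueDiffOn).congr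
      fun x hx => (iteratedFDerivWithin_of_isOpen k ho hx).symm
  have h2 : Continuous fun n : UnitSphere => ‖iteratedFDeriv ℝ k (inChart f) n‖ := by
    refine (h1.comp_continuous continuous_subtype_val fun n => ?_).norm
    exact Metric.ne_of_mem_sphere n.2 one_ne_zero
  exact (isCompact_range h2).bddAbove

lemma contDiffAt_inChart {f : FutureCone → ℝ} (hf : IsSmooth f) (k : ℕ) (n : UnitSphere) :
    ContDiffAt ℝ k (inChart f) n :=
  (hf.contDiffAt (isOpen_compl_singleton.mem_nhds
    (Metric.ne_of_mem_sphere n.2 one_ne_zero))).of_le (mod_cast le_top)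

instance : Nonempty UnitSphere :=
  (NormedSpace.sphere_nonempty.2 zero_le_one).to_subtype

/-- The seminorm `f ↦ sup_{n ∈ S³} ‖D^k f(n)‖` on boundary data. -/
def derivSeminorm (Δ : ℝ) (k : ℕ) : Seminorm ℝ (BoundaryData Δ) :=
  Seminorm.of (fun f => ⨆ n : UnitSphere, ‖iteratedFDeriv ℝ k (inChart f.1) n‖)
    (fun f g => by
      refine ciSup_le fun n => ?_
      have h : iteratedFDeriv ℝ k (inChart (f + g).1) n =
          iteratedFDeriv ℝ k (inChart f.1) n + iteratedFDeriv ℝ k (inChart g.1) n := by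
        rw [show (f + g).1 = f.1 + g.1 from rfl, inChart_add]
        exact iteratedFDeriv_add_apply (contDiffAt_inChart f.2.1 k n)
          (contDiffAt_inChart g.2.1 k n)
      rw [h]
      exact (norm_add_le _ _).trans (add_le_add (le_ciSup (bddAbove_deriv f.2.1 k) n)
        (le_ciSup (bddAbove_deriv g.2.1 k) n)))
    (fun c f => by
      rw [Real.mul_iSup_of_nonneg (norm_nonneg c)]
      refine iSup_congr fun n => ?_
      have h : iteratedFDeriv ℝ k (inChart (c • f).1) n =
          c • iteratedFDeriv ℝ k (inChart f.1) n := by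
        rw [show (c • f).1 = c • f.1 from rfl, inChart_smul]
        exact iteratedFDeriv_const_smul_apply (contDiffAt_inChart f.2.1 k n)
      rw [h, norm_smul])

/-- The smooth (`C^∞`) topology on boundary data: uniform convergence of all derivatives on the
unit sphere (hence, by homogeneity, on every compact subset of the cone). -/
instance boundaryTopology (Δ : ℝ) : TopologicalSpace (BoundaryData Δ) :=
  (SeminormFamily.moduleFilterBasis (𝕜 := ℝ) (derivSeminorm Δ)).topology

lemma withSeminorms_boundary (Δ : ℝ) : WithSeminorms (𝕜 := ℝ) (derivSeminorm Δ) := ⟨rfl⟩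

/-- A symplectic form on boundary data: a continuous bilinear form that is antisymmetric and
(weakly) nondegenerate, i.e. `Ω(f₁, f₂) = 0` for all `f₂` only if `f₁ = 0`. -/
structure IsSymplecticForm {Δ : ℝ} (Ω : BoundaryData Δ →ₗ[ℝ] BoundaryData Δ →ₗ[ℝ] ℝ) : Prop where
  continuous : Continuous fun p : BoundaryData Δ × BoundaryData Δ => Ω p.1 p.2
  antisymm : ∀ f₁ f₂, Ω f₁ f₂ = -Ω f₂ f₁
  nondegenerate : ∀ f₁, (∀ f₂, Ω f₁ f₂ = 0) → f₁ = 0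

end DeSitter

end

/-!
Only the rotation subgroup `SO(4)` of `SO⁺(4,1)` and continuity matter: an invariant bilinear form
on functions on the 3-sphere is automatically symmetric, because any two points of the sphere are
exchanged by a rotation. A form that is also antisymmetric therefore vanishes, which contradicts
nondegeneracy, as there are nonzero boundary data of every weight (`ofSmooth_one_ne_zero`).

To make this precise, restriction to the unit sphere followed by homogeneous extension maps the
smooth functions on `ℝ⁴` onto the boundary data (`ofSmooth`, `exists_ofSmooth_eq`) and intertwines
rotations (`boundaryRep_ofRotation`). It thus suffices to treat the form `B` pulled back to smooth
functions. For vectors `y`, `z` of equal length, a rotation exchanging them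
(`exists_rotation_swap`) gives `B (⟪y, x⟫ ^ n, ⟪z, x⟫ ^ n) = B (⟪z, x⟫ ^ n, ⟪y, x⟫ ^ n)`, hence zero.
Scaling and polarization (`apply_mul_eq_zero_of_apply_mul_pow`) extend this to all homogeneous
polynomials of the same degree. Since `‖x‖² = 1` on the sphere, degrees can be raised by two, and
`-1 ∈ SO(4)` separates even from odd degrees, so `B` vanishes on all polynomials
(`apply_eq_zero_of_mem`).

Polynomials are dense in the `C^∞` topology (`exists_polynomial_tendsto`): convolutions of a
compactly supported function with the Landau kernels, multiples of `(1 - ‖y‖² / 9) ^ n` on a ball,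
converge together with all derivatives (`exists_norm_iteratedFDeriv_landau_sub_le`), and they agree
on the unit sphere with polynomials (`exists_polynomial_eq_landau`).
-/

open Filter Topology MeasureTheory

namespace DeSitter

noncomputable section

/-! ### Boundary data from functions on `ℝ⁴` -/

/-- The algebra of smooth functions on the spatial `ℝ⁴`. -/
def smoothFunctions : Subalgebra ℝ (Space → ℝ) where
  carrier := {G | ContDiff ℝ ∞ G}
  mul_mem' := fun {F G} (hF : ContDiff ℝ ∞ F) (hG : ContDiff ℝ ∞ G) => hF.mul hG
  add_mem' := fun {F G} (hF : ContDiff ℝ ∞ F) (hG : ContDiff ℝ ∞ G) => hF.add hG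
  algebraMap_mem' c := (contDiff_const : ContDiff ℝ ∞ fun _ : Space => c)

lemma contDiff_smoothFunctions (G : smoothFunctions) : ContDiff ℝ ∞ G.1 := G.2

lemma contDiffOn_norm_rpow (a : ℝ) : ContDiffOn ℝ ∞ (fun x : Space => ‖x‖ ^ a) {0}ᶜ :=
  fun _ hx => ((contDiffAt_norm ℝ hx).rpow_const_of_ne (norm_ne_zero_iff.2 hx)).contDiffWithinAt

lemma contDiffOn_normalize : ContDiffOn ℝ ∞ (fun x : Space => ‖x‖⁻¹ • x) {0}ᶜ :=
  fun _ hx => (((contDiffAt_norm ℝ hx).inv (norm_ne_zero_iff.2 hx)).smul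
    contDiffAt_id).contDiffWithinAt

lemma spatial_lightVec (x : Space) : spatial (lightVec x) = x := by
  ext i
  simp [spatial, lightVec]

lemma lightVec_zero_apply (x : Space) : lightVec x 0 = ‖x‖ := by simp [lightVec]

/-- The homogeneous function of weight `Δ` on the cone that restricts to `G` on the unit sphere. -/
def homogeneousExtension (Δ : ℝ) (G : Space → ℝ) (ℓ : FutureCone) : ℝ :=
  (ℓ.1 0) ^ (-Δ) * G ((ℓ.1 0)⁻¹ • spatial ℓ.1)

lemma inChart_homogeneousExtension (Δ : ℝ) (G : Space → ℝ) {x : Space} (hx : x ≠ 0) :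
    inChart (homogeneousExtension Δ G) x = ‖x‖ ^ (-Δ) * G (‖x‖⁻¹ • x) := by
  simp only [inChart, dif_pos hx, homogeneousExtension, spatial_lightVec, lightVec_zero_apply]

lemma contDiffOn_homogeneous (Δ : ℝ) {G : Space → ℝ} (hG : ContDiff ℝ ∞ G) :
    ContDiffOn ℝ ∞ (fun x : Space => ‖x‖ ^ (-Δ) * G (‖x‖⁻¹ • x)) {0}ᶜ :=
  (contDiffOn_norm_rpow _).mul (hG.comp_contDiffOn contDiffOn_normalize)

lemma homogeneousExtension_mem (Δ : ℝ) {G : Space → ℝ} (hG : ContDiff ℝ ∞ G) :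
    homogeneousExtension Δ G ∈ boundarySubmodule Δ := by
  refine ⟨(contDiffOn_homogeneous Δ hG).congr fun x hx => inChart_homogeneousExtension Δ G hx,
    fun c hc ℓ => ?_⟩
  have h0 : 0 < ℓ.1 0 := ℓ.2.2
  have hs : spatial (c • ℓ.1) = c • spatial ℓ.1 := rfl
  simp only [homogeneousExtension, Pi.smul_apply, smul_eq_mul, hs]
  rw [Real.mul_rpow hc.le h0.le, smul_smul, mul_inv_rev, mul_assoc (ℓ.1 0)⁻¹,
    inv_mul_cancel₀ hc.ne', mul_one, mul_assoc]

/-- Boundary data of weight `Δ` obtained from the values of a smooth function on the unit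
sphere. -/
def ofSmooth (Δ : ℝ) : smoothFunctions →ₗ[ℝ] BoundaryData Δ where
  toFun G := ⟨homogeneousExtension Δ G.1, homogeneousExtension_mem Δ (contDiff_smoothFunctions G)⟩
  map_add' _ _ := Subtype.ext <| funext fun _ => mul_add _ _ _
  map_smul' _ _ := Subtype.ext <| funext fun _ => mul_left_comm _ _ _

lemma norm_inv_smul_spatial (ℓ : FutureCone) : ‖(ℓ.1 0)⁻¹ • spatial ℓ.1‖ = 1 := by
  rw [norm_smul, norm_spatial ℓ.2, norm_inv, Real.norm_of_nonneg ℓ.2.2.le,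
    inv_mul_cancel₀ ℓ.2.2.ne']

lemma ofSmooth_congr {Δ : ℝ} {F G : smoothFunctions}
    (h : ∀ x : Space, ‖x‖ = 1 → F.1 x = G.1 x) : ofSmooth Δ F = ofSmooth Δ G :=
  Subtype.ext <| funext fun ℓ => congrArg _ (h _ (norm_inv_smul_spatial ℓ))

/-- Boundary data on the cone extend, near the unit sphere, to a compactly supported smooth
function on `ℝ⁴`. -/
lemma exists_ofSmooth_eq {Δ : ℝ} (f : BoundaryData Δ) :
    ∃ F : smoothFunctions, HasCompactSupport F.1 ∧ (∀ x, F.1 x ≠ 0 → ‖x‖ ≤ 2) ∧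
      ofSmooth Δ F = f := by
  let ψ : ContDiffBump (1 : ℝ) := ⟨1 / 4, 1 / 2, by norm_num, by norm_num⟩
  let F : Space → ℝ := fun x => ψ (‖x‖ ^ 2) * inChart f.1 x
  have hψ : ContDiff ℝ ∞ fun x : Space => ψ (‖x‖ ^ 2) := ψ.contDiff.comp (contDiff_norm_sq ℝ)
  have hzero : ∀ x : Space, ‖x‖ ^ 2 ≤ 1 / 2 ∨ 3 / 2 ≤ ‖x‖ ^ 2 → F x = 0 := by
    intro x hx
    have : ψ (‖x‖ ^ 2) = 0 := by
      refine ψ.zero_of_le_dist ?_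
      rw [Real.dist_eq]
      change 1 / 2 ≤ _
      rcases hx with hx | hx
      · exact le_trans (by linarith) (neg_le_abs _)
      · exact le_trans (by linarith) (le_abs_self _)
    simp [F, this]
  have hF : ContDiff ℝ ∞ F := by
    rw [contDiff_iff_contDiffAt]
    intro x
    by_cases hx : x = 0
    · subst hx
      have hev : F =ᶠ[𝓝 0] fun _ => 0 := by
        have : ∀ᶠ x : Space in 𝓝 0, ‖x‖ ^ 2 < 1 / 2 := by
          refine ContinuousAt.eventually_lt (by fun_prop) continuousAt_const ?_
          norm_num
        filter_upwards [this] with x hx using hzero x (Or.inl hx.le)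
      exact contDiffAt_const.congr_of_eventuallyEq hev
    · exact hψ.contDiffAt.mul (f.2.1.contDiffAt (isOpen_compl_singleton.mem_nhds hx))
  have hb : ∀ x, F x ≠ 0 → ‖x‖ ≤ 2 := by
    intro x hx
    by_contra! h
    exact hx (hzero x (Or.inr (by nlinarith)))
  refine ⟨⟨F, hF⟩, ?_, hb, ?_⟩
  · refine HasCompactSupport.intro (isCompact_closedBall (0 : Space) 2) fun x hx => ?_
    by_contra h
    exact hx (by simpa using hb x h)
  · refine Subtype.ext (funext fun ℓ => ?_)
    change homogeneousExtension Δ F ℓ = f.1 ℓ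
    have h1 := norm_inv_smul_spatial ℓ
    have h0 : 0 < ℓ.1 0 := ℓ.2.2
    have hne : (ℓ.1 0)⁻¹ • spatial ℓ.1 ≠ 0 := by
      rw [← norm_ne_zero_iff, h1]; exact one_ne_zero
    have hψ1 : ψ 1 = 1 := ψ.one_of_mem_closedBall (by simp [ψ.rIn_pos.le])
    have hlv : lightVec ((ℓ.1 0)⁻¹ • spatial ℓ.1) = (ℓ.1 0)⁻¹ • ℓ.1 := by
      have hm := smul_mem_futureCone (inv_pos.2 h0) ℓ.2
      have hs : (ℓ.1 0)⁻¹ • spatial ℓ.1 = spatial ((ℓ.1 0)⁻¹ • ℓ.1) := rfl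
      rw [hs, lightVec_spatial hm]
    have hc : inChart f.1 ((ℓ.1 0)⁻¹ • spatial ℓ.1) = ((ℓ.1 0)⁻¹) ^ (-Δ) * f.1 ℓ := by
      rw [inChart, dif_pos hne, ← f.2.2 _ (inv_pos.2 h0) ℓ]
      exact congrArg f.1 (Subtype.ext hlv)
    simp only [homogeneousExtension, F]
    rw [h1, one_pow, hψ1, one_mul, hc]
    rw [← mul_assoc, ← Real.mul_rpow h0.le (inv_pos.2 h0).le, mul_inv_cancel₀ h0.ne',
      Real.one_rpow, one_mul]

/-! ### Rotations of `ℝ⁴` inside the de Sitter group -/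

/-- The block matrix `diag (1, A)` acting on the spatial coordinates. -/
def spatialMatrix (A : Matrix (Fin 4) (Fin 4) ℝ) : Matrix (Fin 5) (Fin 5) ℝ :=
  Matrix.of (Fin.cons (Fin.cons 1 0) fun i => Fin.cons 0 (A i))

lemma spatialMatrix_mulVec (A : Matrix (Fin 4) (Fin 4) ℝ) (v : Mink) :
    (spatialMatrix A).mulVec v = Fin.cons (v 0) (A.mulVec fun i => v i.succ) := by
  funext i
  refine Fin.cases ?_ (fun j => ?_) i
  · simp [spatialMatrix, Matrix.mulVec, dotProduct, Fin.sum_univ_succ]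
  · simp [spatialMatrix, Matrix.mulVec, dotProduct, Fin.sum_univ_succ (n := 4)]

lemma det_spatialMatrix (A : Matrix (Fin 4) (Fin 4) ℝ) : (spatialMatrix A).det = A.det := by
  rw [Matrix.det_succ_row_zero, Fin.sum_univ_succ]
  have h : (spatialMatrix A).submatrix Fin.succ Fin.succ = A := by
    ext i j
    simp [spatialMatrix]
  simp [h, Fin.succAbove_zero]
  simp [spatialMatrix]

/-- The matrix of a linear isometry of `ℝ⁴` in the standard basis. -/
def rotationMatrix (R : Space ≃ₗᵢ[ℝ] Space) : Matrix (Fin 4) (Fin 4) ℝ :=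
  LinearMap.toMatrix (EuclideanSpace.basisFun (Fin 4) ℝ).toBasis
    (EuclideanSpace.basisFun (Fin 4) ℝ).toBasis R.toLinearEquiv.toLinearMap

lemma rotationMatrix_mulVec (R : Space ≃ₗᵢ[ℝ] Space) (x : Space) :
    (rotationMatrix R).mulVec x.ofLp = (R x).ofLp :=
  LinearMap.toMatrix_mulVec_repr (EuclideanSpace.basisFun (Fin 4) ℝ).toBasis
    (EuclideanSpace.basisFun (Fin 4) ℝ).toBasis R.toLinearEquiv.toLinearMap x

lemma spatialMatrix_rotationMatrix_mulVec (R : Space ≃ₗᵢ[ℝ] Space) (v : Mink) :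
    (spatialMatrix (rotationMatrix R)).mulVec v = Fin.cons (v 0) (R (spatial v)).ofLp := by
  rw [spatialMatrix_mulVec]
  exact congrArg (Fin.cons (α := fun _ => ℝ) (v 0)) (rotationMatrix_mulVec R (spatial v))

lemma dot_eq_inner (v w : Mink) : dot v w = -(v 0 * w 0) + inner ℝ (spatial v) (spatial w) := by
  simp [dot, spatial, PiLp.inner_apply, mul_comm]

lemma dot_rotation (R : Space ≃ₗᵢ[ℝ] Space) (v w : Mink) :
    dot ((spatialMatrix (rotationMatrix R)).mulVec v)
      ((spatialMatrix (rotationMatrix R)).mulVec w) = dot v w := by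
  have h : ∀ u : Mink, spatial (Fin.cons (u 0) (R (spatial u)).ofLp) = R (spatial u) :=
    fun u => by ext i; simp [spatial]
  rw [spatialMatrix_rotationMatrix_mulVec, spatialMatrix_rotationMatrix_mulVec, dot_eq_inner,
    dot_eq_inner, h, h, R.inner_map_map]
  simp

/-- A rotation of `ℝ⁴` as an element of `SO⁺(4,1)`. -/
def ofRotation (R : Space ≃ₗᵢ[ℝ] Space) (hR : LinearMap.det R.toLinearEquiv.toLinearMap = 1) :
    SOPlus41 :=
  ⟨⟨⟨spatialMatrix (rotationMatrix R), by
      rw [det_spatialMatrix, rotationMatrix, LinearMap.det_toMatrix, hR]⟩, dot_rotation R⟩, by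
    intro ℓ
    have h := dot_rotation R ℓ ℓ
    have h0 : (spatialMatrix (rotationMatrix R)).mulVec ℓ 0 = ℓ 0 := by
      rw [spatialMatrix_rotationMatrix_mulVec, Fin.cons_zero]
    change (_ = _ ∧ _ < _) ↔ (_ = _ ∧ _ < _)
    rw [h, h0]⟩

/-- Precomposition with a linear isometry, as an endomorphism of the algebra of smooth
functions. -/
def rotate (R : Space ≃ₗᵢ[ℝ] Space) : smoothFunctions →ₐ[ℝ] smoothFunctions where
  toFun G := ⟨fun x => G.1 (R x), (contDiff_smoothFunctions G).comp R.contDiff⟩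
  map_one' := rfl
  map_mul' _ _ := rfl
  map_zero' := rfl
  map_add' _ _ := rfl
  commutes' _ := rfl

lemma boundaryRep_ofRotation (Δ : ℝ) (R : Space ≃ₗᵢ[ℝ] Space)
    (hR : LinearMap.det R.toLinearEquiv.toLinearMap = 1) (G : smoothFunctions) :
    boundaryRep Δ (ofRotation R hR)⁻¹ (ofSmooth Δ G) = ofSmooth Δ (rotate R G) := by
  refine Subtype.ext (funext fun ℓ => ?_)
  change homogeneousExtension Δ G.1 (moveCone (ofRotation R hR)⁻¹⁻¹ ℓ) =
    homogeneousExtension Δ (rotate R G).1 ℓ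
  have h : (moveCone (ofRotation R hR) ℓ).1 = Fin.cons (ℓ.1 0) (R (spatial ℓ.1)).ofLp :=
    spatialMatrix_rotationMatrix_mulVec R ℓ.1
  have hs : spatial (moveCone (ofRotation R hR) ℓ).1 = R (spatial ℓ.1) := by
    rw [h]; ext i; simp [spatial]
  have h0 : (moveCone (ofRotation R hR) ℓ).1 0 = ℓ.1 0 := by rw [h, Fin.cons_zero]
  rw [inv_inv]
  simp only [homogeneousExtension, hs, h0]
  rw [← R.map_smul]
  rfl

/-- Any two vectors of equal length in `ℝ⁴` are exchanged by a rotation: the product of the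
reflection in their difference and a reflection in a vector orthogonal to both. -/
lemma exists_rotation_swap {y z : Space} (hyz : y ≠ z) (h : ‖y‖ = ‖z‖) :
    ∃ R : Space ≃ₗᵢ[ℝ] Space, LinearMap.det R.toLinearEquiv.toLinearMap = 1 ∧
      R y = z ∧ R z = y := by
  obtain ⟨w, hw, hw0⟩ : ∃ w ∈ (Submodule.span ℝ {y, z})ᗮ, w ≠ 0 := by
    refine Submodule.exists_mem_ne_zero_of_ne_bot fun hbot => ?_
    have h1 := Submodule.finrank_add_finrank_orthogonal (Submodule.span ℝ ({y, z} : Set Space))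
    have h2 : Module.finrank ℝ (Submodule.span ℝ ({y, z} : Set Space)) ≤ 2 := by
      have := finrank_span_finset_le_card (R := ℝ) ({y, z} : Finset Space)
      simp only [Finset.coe_insert, Finset.coe_singleton] at this
      exact this.trans Finset.card_le_two
    rw [hbot, finrank_bot, finrank_euclideanSpace, Fintype.card_fin] at h1
    omega
  have key : ∀ v : Space, v ≠ 0 →
      LinearMap.det ((ℝ ∙ v)ᗮ.reflection).toLinearMap = (-1 : ℝ) := by
    intro v hv
    rw [Submodule.det_reflection, Submodule.orthogonal_orthogonal, finrank_span_singleton hv,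
      pow_one]
  have hfix : ∀ v ∈ ({y, z} : Set Space), (ℝ ∙ w)ᗮ.reflection v = v := fun v hv => by
    refine Submodule.reflection_mem_subspace_eq_self ?_
    rw [Submodule.mem_orthogonal_singleton_iff_inner_left]
    exact hw v (Submodule.subset_span hv)
  refine ⟨(ℝ ∙ (y - z))ᗮ.reflection.trans (ℝ ∙ w)ᗮ.reflection, ?_, ?_, ?_⟩
  · have : ((ℝ ∙ (y - z))ᗮ.reflection.trans (ℝ ∙ w)ᗮ.reflection).toLinearEquiv.toLinearMap =
        ((ℝ ∙ w)ᗮ.reflection).toLinearMap ∘ₗ ((ℝ ∙ (y - z))ᗮ.reflection).toLinearMap := rfl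
    rw [this, LinearMap.det_comp, key _ hw0, key _ (sub_ne_zero.2 hyz)]
    norm_num
  · change (ℝ ∙ w)ᗮ.reflection ((ℝ ∙ (y - z))ᗮ.reflection y) = z
    rw [Submodule.reflection_sub h, hfix z (by simp)]
  · change (ℝ ∙ w)ᗮ.reflection ((ℝ ∙ (y - z))ᗮ.reflection z) = y
    have : (ℝ ∙ (y - z))ᗮ.reflection z = y := by
      have h' := congrArg (ℝ ∙ (y - z))ᗮ.reflection (Submodule.reflection_sub h)
      rw [Submodule.reflection_reflection] at h'
      exact h'.symm
    rw [this, hfix y (by simp)]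

/-! ### Invariant antisymmetric forms vanish on polynomials -/

/-- A linear functional on a commutative algebra that kills `q * y ^ m` for all `y` in a subspace
`W` kills `q * p` for all `p ∈ W ^ m`: powers of elements of `W` polarize to products. -/
lemma apply_mul_eq_zero_of_apply_mul_pow {A : Type*} [CommRing A] [Algebra ℝ A] (W : Submodule ℝ A)
    (L : A →ₗ[ℝ] ℝ) (m : ℕ) (q : A) (h : ∀ y ∈ W, L (q * y ^ m) = 0) {p : A}
    (hp : p ∈ W ^ m) : L (q * p) = 0 := by
  induction m generalizing q p with
  | zero =>
    rw [pow_zero] at hp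
    obtain ⟨c, rfl⟩ := Submodule.mem_one.1 hp
    have h1 := h 0 W.zero_mem
    rw [pow_zero, mul_one] at h1
    rw [mul_comm, ← Algebra.smul_def, map_smul, h1, smul_zero]
  | succ m ih =>
    rw [pow_succ'] at hp
    refine Submodule.mul_induction_on hp (fun u hu p' hp' => ?_) fun a b ha hb => ?_
    · rw [← mul_assoc]
      refine ih (q * u) (fun y hy => ?_) hp'
      -- The polynomial `t ↦ L (q * (t • u + y) ^ (m + 1))` vanishes; its linear coefficient is
      -- `(m + 1) * L (q * u * y ^ m)`.
      let P : Polynomial ℝ := ∑ i ∈ Finset.range (m + 1 + 1),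
        Polynomial.C (L (q * (u ^ i * y ^ (m + 1 - i) * ((m + 1).choose i : A)))) *
          Polynomial.X ^ i
      have hP : P = 0 := by
        refine Polynomial.funext fun t => ?_
        have ht := h (t • u + y) (W.add_mem (W.smul_mem t hu) hy)
        rw [add_pow, Finset.mul_sum, map_sum] at ht
        rw [Polynomial.eval_zero, ← ht, Polynomial.eval_finsetSum]
        refine Finset.sum_congr rfl fun i _ => ?_
        rw [Polynomial.eval_mul, Polynomial.eval_C, Polynomial.eval_pow, Polynomial.eval_X,
          smul_pow, smul_mul_assoc, smul_mul_assoc, mul_smul_comm, map_smul, smul_eq_mul, mul_comm]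
      have hc := congrArg (fun p => Polynomial.coeff p 1) hP
      simp only [P, Polynomial.finsetSum_coeff, Polynomial.coeff_C_mul, Polynomial.coeff_X_pow,
        Polynomial.coeff_zero, mul_ite, mul_one, mul_zero] at hc
      rw [Finset.sum_ite_eq, if_pos (by simp)] at hc
      have he : q * (u ^ 1 * y ^ (m + 1 - 1) * ((m + 1).choose 1 : A)) =
          ((m + 1 : ℕ) : ℝ) • (q * u * y ^ m) := by
        rw [Nat.choose_one_right, Algebra.smul_def, map_natCast, pow_one, Nat.add_sub_cancel]
        ring
      rw [he, map_smul, smul_eq_mul] at hc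
      exact (mul_eq_zero.1 hc).resolve_left (by positivity)
    · rw [mul_add, map_add, ha, hb, add_zero]

/-- The linear form `x ↦ ⟪y, x⟫` as a smooth function. -/
def linearForm : Space →ₗ[ℝ] smoothFunctions where
  toFun y := ⟨fun x => inner ℝ y x, show ContDiff ℝ ∞ _ from (innerSL ℝ y).contDiff⟩
  map_add' _ _ := Subtype.ext <| funext fun _ => inner_add_left _ _ _
  map_smul' _ _ := Subtype.ext <| funext fun _ => real_inner_smul_left _ _ _

/-- The space of linear forms on `ℝ⁴`; its `n`-th power is the space of homogeneous polynomials of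
degree `n`. -/
def linearForms : Submodule ℝ smoothFunctions := LinearMap.range linearForm

lemma rotate_linearForm (R : Space ≃ₗᵢ[ℝ] Space) (y : Space) :
    rotate R (linearForm (R y)) = linearForm y :=
  Subtype.ext <| funext fun x => R.inner_map_map y x

lemma rotate_neg_of_mem {n : ℕ} {p : smoothFunctions} (hp : p ∈ linearForms ^ n) :
    rotate (LinearIsometryEquiv.neg ℝ) p = (-1 : ℝ) ^ n • p := by
  induction n generalizing p with
  | zero =>
    rw [pow_zero] at hp
    obtain ⟨c, rfl⟩ := Submodule.mem_one.1 hp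
    rw [AlgHom.commutes, pow_zero, one_smul]
  | succ n ih =>
    rw [pow_succ'] at hp
    refine Submodule.mul_induction_on hp ?_ fun a b ha hb => ?_
    · rintro _ ⟨y, rfl⟩ p' hp'
      have hy : rotate (LinearIsometryEquiv.neg ℝ) (linearForm y) = (-1 : ℝ) • linearForm y :=
        Subtype.ext <| funext fun x => (inner_neg_right y x).trans (neg_one_mul _).symm
      rw [map_mul, hy, ih hp', smul_mul_smul_comm, pow_succ']
    · rw [map_add, ha, hb, smul_add]

/-- The square of the Euclidean norm, as a smooth function. -/
def normSq : smoothFunctions := ⟨fun x => ‖x‖ ^ 2, show ContDiff ℝ ∞ _ from contDiff_norm_sq ℝ⟩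

lemma normSq_mem : normSq ∈ linearForms ^ 2 := by
  have h : normSq = ∑ i : Fin 4, linearForm (EuclideanSpace.single i 1) *
      linearForm (EuclideanSpace.single i 1) := by
    refine Subtype.ext <| funext fun x => ?_
    rw [AddSubmonoidClass.coe_finsetSum, Finset.sum_apply]
    change ‖x‖ ^ 2 = ∑ i, inner ℝ (EuclideanSpace.single i (1 : ℝ)) x *
      inner ℝ (EuclideanSpace.single i (1 : ℝ)) x
    rw [EuclideanSpace.real_norm_sq_eq]
    exact Finset.sum_congr rfl fun i _ => by simp [EuclideanSpace.inner_single_left, sq]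
  rw [h, pow_two]
  exact Submodule.sum_mem _ fun i _ => Submodule.mul_mem_mul ⟨_, rfl⟩ ⟨_, rfl⟩

lemma det_neg_isometry :
    LinearMap.det (LinearIsometryEquiv.neg ℝ (E := Space)).toLinearEquiv.toLinearMap = 1 := by
  have h : (LinearIsometryEquiv.neg ℝ (E := Space)).toLinearEquiv.toLinearMap =
      (-1 : ℝ) • LinearMap.id := by
    ext1 x
    simp
  rw [h, LinearMap.det_smul, LinearMap.det_id, finrank_euclideanSpace, Fintype.card_fin]
  norm_num

/-- A rotation exchanging `y` and `z` shows that the pairing of the `n`-th powers of two linear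
forms of equal length is symmetric, hence zero; the case of unequal lengths follows by scaling. -/
lemma apply_linearForm_pow_eq_zero (B : smoothFunctions →ₗ[ℝ] smoothFunctions →ₗ[ℝ] ℝ)
    (hanti : ∀ F G, B F G = -B G F)
    (hrot : ∀ R : Space ≃ₗᵢ[ℝ] Space, LinearMap.det R.toLinearEquiv.toLinearMap = 1 →
      ∀ F G, B (rotate R F) (rotate R G) = B F G)
    (n : ℕ) (y z : Space) :
    B (linearForm y ^ n) (linearForm z ^ n) = 0 := by
  have heq : ∀ y z : Space, ‖y‖ = ‖z‖ → B (linearForm y ^ n) (linearForm z ^ n) = 0 := by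
    intro y z h
    have hs : B (linearForm y ^ n) (linearForm z ^ n) =
        B (linearForm z ^ n) (linearForm y ^ n) := by
      by_cases hyz : y = z
      · rw [hyz]
      · obtain ⟨R, hR, hy, hz⟩ := exists_rotation_swap hyz h
        have h1 : rotate R (linearForm z) = linearForm y := by
          rw [← hy, rotate_linearForm]
        have h2 : rotate R (linearForm y) = linearForm z := by
          conv_lhs => rw [← hz]
          exact rotate_linearForm R z
        rw [← hrot R hR (linearForm z ^ n), map_pow (rotate R), map_pow (rotate R), h1, h2]
    linarith [hanti (linearForm y ^ n) (linearForm z ^ n)]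
  rcases Nat.eq_zero_or_pos n with rfl | hn
  · simpa using heq 0 0 rfl
  by_cases hy : y = 0
  · rw [hy, map_zero linearForm, zero_pow hn.ne', map_zero, LinearMap.zero_apply]
  by_cases hz : z = 0
  · rw [hz, map_zero linearForm, zero_pow hn.ne', map_zero]
  have hy' := norm_ne_zero_iff.2 hy
  have hz' := norm_ne_zero_iff.2 hz
  have h := heq y ((‖y‖ / ‖z‖) • z) (by
    rw [norm_smul, norm_div, norm_norm, norm_norm, div_mul_cancel₀ _ hz'])
  rw [map_smul, smul_pow, map_smul, smul_eq_mul] at h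
  exact (mul_eq_zero.1 h).resolve_left (pow_ne_zero _ (div_ne_zero hy' hz'))

lemma apply_eq_zero_of_mem_same (B : smoothFunctions →ₗ[ℝ] smoothFunctions →ₗ[ℝ] ℝ)
    (hanti : ∀ F G, B F G = -B G F)
    (hrot : ∀ R : Space ≃ₗᵢ[ℝ] Space, LinearMap.det R.toLinearEquiv.toLinearMap = 1 →
      ∀ F G, B (rotate R F) (rotate R G) = B F G)
    {n : ℕ} {p q : smoothFunctions} (hp : p ∈ linearForms ^ n)
    (hq : q ∈ linearForms ^ n) : B p q = 0 := by
  have h1 : ∀ z : Space, B p (linearForm z ^ n) = 0 := by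
    intro z
    have := apply_mul_eq_zero_of_apply_mul_pow linearForms (B.flip (linearForm z ^ n)) n 1 (by
      rintro _ ⟨y, rfl⟩
      rw [one_mul]
      exact apply_linearForm_pow_eq_zero B hanti hrot n y z) hp
    rwa [one_mul] at this
  have := apply_mul_eq_zero_of_apply_mul_pow linearForms (B p) n 1 (by
    rintro _ ⟨z, rfl⟩
    rw [one_mul]
    exact h1 z) hq
  rwa [one_mul] at this

/-- If `B` depends only on the restrictions to the unit sphere, multiplication by powers of the
squared norm makes the degrees of two polynomials equal when they have the same parity, and `-1`
is a rotation that separates the parities. -/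
lemma apply_eq_zero_of_mem (B : smoothFunctions →ₗ[ℝ] smoothFunctions →ₗ[ℝ] ℝ)
    (hanti : ∀ F G, B F G = -B G F)
    (hrot : ∀ R : Space ≃ₗᵢ[ℝ] Space, LinearMap.det R.toLinearEquiv.toLinearMap = 1 →
      ∀ F G, B (rotate R F) (rotate R G) = B F G)
    (hnorm : ∀ F G, B (normSq * F) G = B F G)
    {m n : ℕ} {p q : smoothFunctions} (hp : p ∈ linearForms ^ m)
    (hq : q ∈ linearForms ^ n) : B p q = 0 := by
  have hpow : ∀ k F G, B (normSq ^ k * F) G = B F G := by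
    intro k F G
    induction k with
    | zero => rw [pow_zero, one_mul]
    | succ k ih => rw [pow_succ', mul_assoc, hnorm, ih]
  have hle : ∀ {k m : ℕ} {p q : smoothFunctions}, p ∈ linearForms ^ m →
      q ∈ linearForms ^ (2 * k + m) → B p q = 0 := by
    intro k m p q hp hq
    rw [← hpow k]
    refine apply_eq_zero_of_mem_same B hanti hrot ?_ hq
    rw [pow_add, pow_mul]
    exact Submodule.mul_mem_mul (Submodule.pow_mem_pow _ normSq_mem k) hp
  rcases Nat.even_or_odd (m + n) with he | ho
  · rcases le_total m n with hmn | hmn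
    · obtain ⟨k, hk⟩ := he
      exact hle (k := k - m) hp (by convert hq using 2; omega)
    · obtain ⟨k, hk⟩ := he
      rw [hanti, hle (k := k - n) hq (by convert hp using 2; omega), neg_zero]
  · have h := hrot _ det_neg_isometry p q
    rw [rotate_neg_of_mem hp, rotate_neg_of_mem hq, map_smul, map_smul, LinearMap.smul_apply,
      smul_smul, ← pow_add, add_comm n m, ho.neg_one_pow, smul_eq_mul] at h
    linarith

/-! ### Continuity of the passage from smooth functions to boundary data -/

lemma exists_bound_iteratedFDerivWithin {F : Type*} [NormedAddCommGroup F] [NormedSpace ℝ F]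
    {f : Space → F} (hf : ContDiffOn ℝ ∞ f {0}ᶜ) (k : ℕ) :
    ∃ D : ℝ, 1 ≤ D ∧ ∀ i ≤ k, ∀ x : Space, ‖x‖ = 1 →
      ‖iteratedFDerivWithin ℝ i f {0}ᶜ x‖ ≤ D := by
  have ho : IsOpen ({0}ᶜ : Set Space) := isOpen_compl_singleton
  have h : ∀ i, ∃ C, ∀ x ∈ Metric.sphere (0 : Space) 1,
      ‖iteratedFDerivWithin ℝ i f {0}ᶜ x‖ ≤ C := fun i =>
    (isCompact_sphere (0 : Space) 1).exists_bound_of_continuousOn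
      ((hf.continuousOn_iteratedFDerivWithin (mod_cast le_top) ho.uniqueDiffOn).mono
        fun _ hx => Metric.ne_of_mem_sphere hx one_ne_zero)
  choose C hC using h
  refine ⟨1 + ∑ i ∈ Finset.range (k + 1), |C i|,
    le_add_of_nonneg_right (Finset.sum_nonneg fun _ _ => abs_nonneg _), fun i hi x hx => ?_⟩
  calc _ ≤ C i := hC i x (by simpa using hx)
    _ ≤ |C i| := le_abs_self _
    _ ≤ ∑ i ∈ Finset.range (k + 1), |C i| :=
      Finset.single_le_sum (f := fun i => |C i|) (fun _ _ => abs_nonneg _)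
        (Finset.mem_range.2 (by omega))
    _ ≤ _ := le_add_of_nonneg_left zero_le_one

lemma exists_derivSeminorm_ofSmooth_le (Δ : ℝ) (k : ℕ) :
    ∃ C : ℝ, ∀ (G : smoothFunctions) (M : ℝ),
      (∀ i ≤ k, ∀ x, ‖iteratedFDeriv ℝ i G.1 x‖ ≤ M) →
      derivSeminorm Δ k (ofSmooth Δ G) ≤ C * M := by
  obtain ⟨D₁, hD₁, h₁⟩ := exists_bound_iteratedFDerivWithin (contDiffOn_norm_rpow (-Δ)) k
  obtain ⟨D₂, hD₂, h₂⟩ := exists_bound_iteratedFDerivWithin contDiffOn_normalize k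
  refine ⟨∑ i ∈ Finset.range (k + 1), (k.choose i : ℝ) * D₁ * ((k - i).factorial * D₂ ^ (k - i)),
    fun G M hM => ?_⟩
  have ho : IsOpen ({0}ᶜ : Set Space) := isOpen_compl_singleton
  have hG := contDiff_smoothFunctions G
  change (⨆ n : UnitSphere, ‖iteratedFDeriv ℝ k (inChart (homogeneousExtension Δ G.1)) n‖) ≤ _
  refine ciSup_le fun ⟨x, hx⟩ => ?_
  have hx1 : ‖x‖ = 1 := by simpa using hx
  have hx0 : x ∈ ({0}ᶜ : Set Space) := Metric.ne_of_mem_sphere hx one_ne_zero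
  have hk : ∀ j : ℕ, (j : ℕ∞ω) ≤ ∞ := fun j => mod_cast le_top
  rw [← iteratedFDerivWithin_of_isOpen k ho hx0,
    iteratedFDerivWithin_congr (f₁ := inChart (homogeneousExtension Δ G.1)) (s := {0}ᶜ)
      (fun y hy => inChart_homogeneousExtension Δ G.1 hy) hx0]
  refine (norm_iteratedFDerivWithin_mul_le (contDiffOn_norm_rpow (-Δ))
    (hG.comp_contDiffOn contDiffOn_normalize) ho.uniqueDiffOn hx0 (hk k)).trans ?_
  rw [Finset.sum_mul]
  refine Finset.sum_le_sum fun i hi => ?_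
  have hi' : i ≤ k := by have := Finset.mem_range.1 hi; omega
  have hcomp : ‖iteratedFDerivWithin ℝ (k - i) (G.1 ∘ fun x : Space => ‖x‖⁻¹ • x) {0}ᶜ x‖ ≤
      (k - i).factorial * M * D₂ ^ (k - i) := by
    refine norm_iteratedFDerivWithin_comp_le (t := Set.univ) hG.contDiffOn contDiffOn_normalize
      (hk (k - i)) uniqueDiffOn_univ ho.uniqueDiffOn
      (Set.mapsTo_univ _ _) hx0 (fun j hj => ?_) fun j hj1 hj => ?_
    · rw [iteratedFDerivWithin_univ]
      exact hM j (by omega) _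
    · exact (h₂ j (by omega) x hx1).trans (le_self_pow₀ hD₂ (by omega))
  have hM0 : 0 ≤ M := (norm_nonneg _).trans (hM 0 (Nat.zero_le _) 0)
  calc _ ≤ (k.choose i : ℝ) * D₁ * ((k - i).factorial * M * D₂ ^ (k - i)) := by
        gcongr
        exact h₁ i hi' x hx1
    _ = _ := by ring

/-! ### Approximation by polynomials in the smooth topology -/

/-- The profile `1 - ‖y‖² / 9`, whose powers concentrate at the origin of the ball of
radius `3`. -/
def landauProfile (y : Space) : ℝ := 1 - ‖y‖ ^ 2 / 9

lemma continuous_landauProfile : Continuous landauProfile := by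
  unfold landauProfile
  fun_prop

lemma landauProfile_nonneg {y : Space} (hy : y ∈ Metric.closedBall (0 : Space) 3) :
    0 ≤ landauProfile y := by
  have : ‖y‖ ≤ 3 := by simpa using hy
  unfold landauProfile
  nlinarith [norm_nonneg y]

/-- The total mass of `landauProfile ^ n` on the ball of radius `3`. -/
def landauMass (n : ℕ) : ℝ := ∫ y in Metric.closedBall (0 : Space) 3, landauProfile y ^ n

/-- The Landau kernel: a probability density on the ball of radius `3` of `ℝ⁴`, given there by a
multiple of `(1 - ‖y‖² / 9) ^ n`. -/
def landauKernel (n : ℕ) : Space → ℝ :=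
  (Metric.closedBall 0 3).indicator fun y => (landauMass n)⁻¹ * landauProfile y ^ n

lemma integrableOn_landauProfile_pow (n : ℕ) :
    IntegrableOn (fun y => landauProfile y ^ n) (Metric.closedBall (0 : Space) 3) :=
  (continuous_landauProfile.pow n).continuousOn.integrableOn_compact (isCompact_closedBall _ _)

lemma landauMass_pos (n : ℕ) : 0 < landauMass n := by
  refine (setIntegral_pos_iff_support_of_nonneg_ae ?_ (integrableOn_landauProfile_pow n)).2 ?_
  · filter_upwards [ae_restrict_mem measurableSet_closedBall] with y hy
      using pow_nonneg (landauProfile_nonneg hy) n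
  · refine (Metric.measure_ball_pos volume (0 : Space) (by norm_num : (0 : ℝ) < 3)).trans_le
      (measure_mono fun y hy => ⟨?_, Metric.ball_subset_closedBall hy⟩)
    have : ‖y‖ < 3 := by simpa using hy
    refine pow_ne_zero n (ne_of_gt ?_)
    unfold landauProfile
    nlinarith [norm_nonneg y]

lemma landauKernel_nonneg (n : ℕ) (y : Space) : 0 ≤ landauKernel n y :=
  Set.indicator_nonneg (fun _ hy => mul_nonneg (inv_nonneg.2 (landauMass_pos n).le)
    (pow_nonneg (landauProfile_nonneg hy) n)) y

lemma integrable_landauKernel (n : ℕ) : Integrable (landauKernel n) :=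
  IntegrableOn.integrable_indicator ((integrableOn_landauProfile_pow n).const_mul _)
    measurableSet_closedBall

lemma integral_landauKernel (n : ℕ) : ∫ y, landauKernel n y = 1 := by
  rw [landauKernel, integral_indicator measurableSet_closedBall, integral_const_mul]
  exact inv_mul_cancel₀ (landauMass_pos n).ne'

lemma integrable_landauKernel_mul_norm (n : ℕ) : Integrable fun y => landauKernel n y * ‖y‖ := by
  have h : (fun y => landauKernel n y * ‖y‖) = (Metric.closedBall (0 : Space) 3).indicator
      fun y => (landauMass n)⁻¹ * landauProfile y ^ n * ‖y‖ := by
    funext y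
    simp only [landauKernel, Set.indicator]
    split_ifs <;> simp
  rw [h]
  refine IntegrableOn.integrable_indicator ?_ measurableSet_closedBall
  exact ((continuous_const.mul (continuous_landauProfile.pow n)).mul
    continuous_norm).continuousOn.integrableOn_compact (isCompact_closedBall _ _)

lemma tendsto_integral_landauKernel_mul_norm :
    Tendsto (fun n => ∫ y, landauKernel n y * ‖y‖) atTop (𝓝 0) := by
  have h := tendsto_setIntegral_pow_smul_of_unique_maximum_of_isCompact_of_continuousOn
    (μ := (volume : Measure Space)) (x₀ := 0) (g := fun y : Space => ‖y‖)
    (isCompact_closedBall (0 : Space) 3) continuous_landauProfile.continuousOn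
    (fun y _ hy => by
      have := norm_pos_iff.2 hy
      simp only [landauProfile, norm_zero]
      nlinarith)
    (fun y hy => landauProfile_nonneg hy) (by simp [landauProfile])
    (by
      rw [interior_closedBall _ (by norm_num)]
      exact subset_closure (by simp))
    continuous_norm.continuousOn
  rw [norm_zero] at h
  refine h.congr fun n => ?_
  rw [smul_eq_mul, ← integral_const_mul, ← integral_indicator measurableSet_closedBall]
  refine integral_congr_ae (Eventually.of_forall fun y => ?_)
  simp only [landauKernel, Set.indicator, landauMass, smul_eq_mul]
  split_ifs <;> ring

open scoped Convolution in
/-- Convolution with the Landau kernels approximates a compactly supported smooth function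
uniformly together with all derivatives. The order-zero estimate is the Lipschitz bound, and
differentiation commutes with convolution, so that the statement for `g` of order `k + 1` is the
one for `fderiv ℝ g` of order `k`. -/
lemma exists_norm_iteratedFDeriv_landau_sub_le (k : ℕ) {E : Type} [NormedAddCommGroup E]
    [NormedSpace ℝ E] [CompleteSpace E] {g : Space → E} (hg : ContDiff ℝ ∞ g)
    (hc : HasCompactSupport g) :
    ∃ C : ℝ, ∀ n x, ‖iteratedFDeriv ℝ k
      (fun x => (landauKernel n ⋆[ContinuousLinearMap.lsmul ℝ ℝ, volume] g) x - g x) x‖ ≤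
        C * ∫ y, landauKernel n y * ‖y‖ := by
  induction k generalizing E with
  | zero =>
    obtain ⟨C, hC⟩ := ContDiff.lipschitzWith_of_hasCompactSupport hc hg (by simp)
    refine ⟨C, fun n x => ?_⟩
    rw [norm_iteratedFDeriv_zero]
    have hi : Integrable fun y => landauKernel n y • g (x - y) :=
      hc.convolutionExists_right (ContinuousLinearMap.lsmul ℝ ℝ)
        (integrable_landauKernel n).locallyIntegrable hg.continuous x
    have hi' : Integrable fun y => landauKernel n y • g x :=
      (integrable_landauKernel n).smul_const _
    have h1 : (landauKernel n ⋆[ContinuousLinearMap.lsmul ℝ ℝ, volume] g) x - g x =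
        ∫ y, landauKernel n y • (g (x - y) - g x) := by
      simp_rw [smul_sub]
      rw [integral_sub hi hi', integral_smul_const, integral_landauKernel, one_smul]
      rfl
    rw [h1, ← integral_const_mul]
    refine norm_integral_le_of_norm_le ((integrable_landauKernel_mul_norm n).const_mul _)
      (Eventually.of_forall fun y => ?_)
    rw [norm_smul, Real.norm_of_nonneg (landauKernel_nonneg n y)]
    have := hC.norm_sub_le (x - y) x
    rw [sub_sub_cancel_left, norm_neg] at this
    calc _ ≤ landauKernel n y * (C * ‖y‖) := by
          gcongr
          exact landauKernel_nonneg n y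
      _ = _ := by ring
  | succ k ih =>
    obtain ⟨C, hC⟩ := ih (hg.fderiv_right (m := ∞) (by simp)) (hc.fderiv ℝ)
    refine ⟨C, fun n x => ?_⟩
    rw [← norm_iteratedFDeriv_fderiv]
    convert hC n x using 3
    funext x
    have hd := hc.hasFDerivAt_convolution_right (ContinuousLinearMap.lsmul ℝ ℝ)
      (integrable_landauKernel n).locallyIntegrable (hg.of_le (by simp)) x
    exact (hd.sub (hg.differentiable (by simp) x).hasFDerivAt).fderiv

/-- The polynomial functions on `ℝ⁴`. -/
def polynomials : Submodule ℝ smoothFunctions := ⨆ n : ℕ, linearForms ^ n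

/-- The moments `x ↦ ∫ h(y) ⟪y, x⟫ ^ j dy` of a compactly supported function are homogeneous
polynomials. -/
lemma exists_polynomial_eq_moment (j : ℕ) {h : Space → ℝ} (hh : Continuous h)
    (hc : HasCompactSupport h) :
    ∃ p ∈ linearForms ^ j, ∀ x, p.1 x = ∫ y, h y * inner ℝ y x ^ j := by
  induction j generalizing h with
  | zero =>
    refine ⟨algebraMap ℝ _ (∫ y, h y), ?_, fun x => ?_⟩
    · rw [pow_zero]
      exact Submodule.algebraMap_mem _
    · simp_rw [pow_zero, mul_one]
      rfl
  | succ j ih =>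
    have hcoord : ∀ i : Fin 4, Continuous fun y : Space => y i := fun i => by fun_prop
    choose p hp hpx using fun i : Fin 4 =>
      ih (h := fun y => h y * y i) (hh.mul (hcoord i)) hc.mul_right
    refine ⟨∑ i, linearForm (EuclideanSpace.single i 1) * p i, ?_, fun x => ?_⟩
    · rw [pow_succ']
      exact Submodule.sum_mem _ fun i _ => Submodule.mul_mem_mul ⟨_, rfl⟩ (hp i)
    · rw [AddSubmonoidClass.coe_finsetSum, Finset.sum_apply]
      have hterm : ∀ i, (linearForm (EuclideanSpace.single i 1) * p i).1 x =
          ∫ y, x i * (h y * y i * inner ℝ y x ^ j) := by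
        intro i
        rw [integral_const_mul, ← hpx i x]
        change inner ℝ (EuclideanSpace.single i (1 : ℝ)) x * (p i).1 x = _
        rw [EuclideanSpace.inner_single_left]
        simp
      have hint : ∀ i ∈ Finset.univ,
          Integrable fun y : Space => x i * (h y * y i * inner ℝ y x ^ j) := fun i _ => by
        refine Integrable.const_mul (Continuous.integrable_of_hasCompactSupport ?_ ?_) _
        · exact (hh.mul (hcoord i)).mul ((continuous_id.inner continuous_const).pow j)
        · exact hc.mul_right.mul_right
      rw [Finset.sum_congr rfl fun i _ => hterm i, ← integral_finsetSum _ hint]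
      refine integral_congr_ae (Eventually.of_forall fun y => ?_)
      have hy : inner ℝ y x = ∑ i, x i * y i := by simp [PiLp.inner_apply]
      simp only [pow_succ']
      rw [hy, Finset.sum_mul, Finset.mul_sum]
      exact Finset.sum_congr rfl fun i _ => by ring

open scoped Convolution in
/-- On the unit sphere, convolution with a Landau kernel produces a polynomial, because the
squared distance `‖x - y‖²` is there affine in `x`. -/
lemma exists_polynomial_eq_landau (n : ℕ) {F : Space → ℝ} (hF : Continuous F)
    (hc : HasCompactSupport F) (hb : ∀ x, F x ≠ 0 → ‖x‖ ≤ 2) :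
    ∃ p ∈ polynomials, ∀ x, ‖x‖ = 1 →
      p.1 x = (landauKernel n ⋆[ContinuousLinearMap.lsmul ℝ ℝ, volume] F) x := by
  let h : ℕ → Space → ℝ := fun j y => F y * ((landauMass n)⁻¹ * ((2 / 9) ^ j *
    (1 - (1 + ‖y‖ ^ 2) / 9) ^ (n - j) * (n.choose j : ℝ)))
  have hh : ∀ j, Continuous (h j) := fun j => by
    refine hF.mul ?_
    fun_prop
  have hhc : ∀ j, HasCompactSupport (h j) := fun j => hc.mul_right
  choose p hp hpx using fun j => exists_polynomial_eq_moment j (hh j) (hhc j)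
  refine ⟨∑ j ∈ Finset.range (n + 1), p j,
    Submodule.sum_mem _ fun j _ => Submodule.mem_iSup_of_mem j (hp j), fun x hx => ?_⟩
  have hint : ∀ j ∈ Finset.range (n + 1), Integrable fun y => h j y * inner ℝ y x ^ j :=
    fun j _ => Continuous.integrable_of_hasCompactSupport
      ((hh j).mul ((continuous_id.inner continuous_const).pow j)) (hhc j).mul_right
  rw [AddSubmonoidClass.coe_finsetSum, Finset.sum_apply,
    Finset.sum_congr rfl fun j _ => hpx j x, ← integral_finsetSum _ hint,
    convolution_eq_swap]
  refine integral_congr_ae (Eventually.of_forall fun y => ?_)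
  simp only [ContinuousLinearMap.lsmul_apply, smul_eq_mul]
  by_cases hy : F y = 0
  · simp [h, hy]
  have hmem : x - y ∈ Metric.closedBall (0 : Space) 3 := by
    rw [mem_closedBall_zero_iff]
    linarith [norm_sub_le x y, hb y hy]
  have hprofile : landauProfile (x - y) =
      2 / 9 * inner ℝ y x + (1 - (1 + ‖y‖ ^ 2) / 9) := by
    rw [landauProfile, norm_sub_sq_real, hx, real_inner_comm]
    ring
  rw [landauKernel, Set.indicator_of_mem hmem, hprofile, add_pow, Finset.mul_sum, Finset.sum_mul]
  refine Finset.sum_congr rfl fun j _ => ?_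
  simp only [h, mul_pow]
  ring

/-- The polynomials are sequentially dense in the boundary data. -/
lemma exists_polynomial_tendsto {Δ : ℝ} (f : BoundaryData Δ) :
    ∃ p : ℕ → smoothFunctions, (∀ n, p n ∈ polynomials) ∧
      Tendsto (fun n => ofSmooth Δ (p n)) atTop (𝓝 f) := by
  obtain ⟨F, hc, hb, rfl⟩ := exists_ofSmooth_eq f
  have hF := contDiff_smoothFunctions F
  choose p hp hpx using fun n => exists_polynomial_eq_landau n hF.continuous hc hb
  refine ⟨p, hp, ?_⟩
  let A : ℕ → smoothFunctions := fun n =>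
    ⟨_, show ContDiff ℝ ∞ _ from hc.contDiff_convolution_right (ContinuousLinearMap.lsmul ℝ ℝ)
      (integrable_landauKernel n).locallyIntegrable hF⟩
  have hA : ∀ n, ofSmooth Δ (p n) = ofSmooth Δ (A n) := fun n => ofSmooth_congr (hpx n)
  simp_rw [hA]
  rw [(withSeminorms_boundary Δ).tendsto_nhds]
  intro k ε hε
  obtain ⟨C, hC⟩ := exists_derivSeminorm_ofSmooth_le Δ k
  choose D hD using fun i => exists_norm_iteratedFDeriv_landau_sub_le i hF hc
  let δ : ℕ → ℝ := fun n => ∫ y, landauKernel n y * ‖y‖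
  have hδ : ∀ n, 0 ≤ δ n := fun n =>
    integral_nonneg fun y => mul_nonneg (landauKernel_nonneg n y) (norm_nonneg y)
  have hle : ∀ n, derivSeminorm Δ k (ofSmooth Δ (A n) - ofSmooth Δ F) ≤
      C * ((∑ i ∈ Finset.range (k + 1), |D i|) * δ n) := by
    intro n
    rw [← map_sub]
    refine hC (A n - F) _ fun i hi x => (hD i n x).trans ?_
    refine mul_le_mul_of_nonneg_right ((le_abs_self _).trans ?_) (hδ n)
    exact Finset.single_le_sum (f := fun i => |D i|) (fun _ _ => abs_nonneg _)
      (Finset.mem_range.2 (by omega))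
  have hlim : Tendsto (fun n => C * ((∑ i ∈ Finset.range (k + 1), |D i|) * δ n)) atTop (𝓝 0) := by
    have := (tendsto_integral_landauKernel_mul_norm.const_mul
      (∑ i ∈ Finset.range (k + 1), |D i|)).const_mul C
    rwa [mul_zero, mul_zero] at this
  filter_upwards [hlim.eventually_lt_const hε] with n hn using (hle n).trans_lt hn

/-! ### Invariant symplectic forms -/

/-- A continuous antisymmetric form on boundary data that is invariant under the rotations of
`ℝ⁴` vanishes. -/
lemma apply_eq_zero_of_invariant {Δ : ℝ} {Ω : BoundaryData Δ →ₗ[ℝ] BoundaryData Δ →ₗ[ℝ] ℝ}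
    (hcont : Continuous fun p : BoundaryData Δ × BoundaryData Δ => Ω p.1 p.2)
    (hanti : ∀ f₁ f₂, Ω f₁ f₂ = -Ω f₂ f₁)
    (hinv : ∀ (g : SOPlus41) (f₁ f₂ : BoundaryData Δ),
      Ω (boundaryRep Δ g f₁) (boundaryRep Δ g f₂) = Ω f₁ f₂) (f₁ f₂ : BoundaryData Δ) :
    Ω f₁ f₂ = 0 := by
  let B : smoothFunctions →ₗ[ℝ] smoothFunctions →ₗ[ℝ] ℝ :=
    Ω.compl₁₂ (ofSmooth Δ) (ofSmooth Δ)
  have hBanti : ∀ F G, B F G = -B G F := fun F G => hanti _ _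
  have hrot : ∀ R : Space ≃ₗᵢ[ℝ] Space, LinearMap.det R.toLinearEquiv.toLinearMap = 1 →
      ∀ F G, B (rotate R F) (rotate R G) = B F G := by
    intro R hR F G
    change Ω (ofSmooth Δ (rotate R F)) (ofSmooth Δ (rotate R G)) = _
    rw [← boundaryRep_ofRotation Δ R hR, ← boundaryRep_ofRotation Δ R hR, hinv]
    rfl
  have hnorm : ∀ F G, B (normSq * F) G = B F G := by
    intro F G
    change Ω (ofSmooth Δ (normSq * F)) _ = Ω (ofSmooth Δ F) _
    rw [ofSmooth_congr (F := normSq * F) (G := F)]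
    intro x hx
    change ‖x‖ ^ 2 * F.1 x = F.1 x
    rw [hx, one_pow, one_mul]
  have hpoly : ∀ p ∈ polynomials, ∀ q ∈ polynomials, B p q = 0 := by
    intro p hp q hq
    have hker : polynomials ≤ LinearMap.ker (B p) := by
      refine iSup_le fun n q hq => ?_
      have : polynomials ≤ LinearMap.ker (B.flip q) := iSup_le fun m p hp =>
        apply_eq_zero_of_mem B hBanti hrot hnorm hp hq
      exact this hp
    exact hker hq
  obtain ⟨p, hp, hpf⟩ := exists_polynomial_tendsto f₁
  obtain ⟨q, hq, hqf⟩ := exists_polynomial_tendsto f₂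
  have hlim := (hcont.tendsto (f₁, f₂)).comp (hpf.prodMk_nhds hqf)
  refine tendsto_nhds_unique hlim (tendsto_const_nhds.congr fun n => ?_)
  exact (hpoly _ (hp n) _ (hq n)).symm

lemma ofSmooth_one_ne_zero (Δ : ℝ) : ofSmooth Δ 1 ≠ 0 := by
  intro h
  have hx : (EuclideanSpace.single 0 1 : Space) ≠ 0 := by simp
  have h1 : homogeneousExtension Δ 1 ⟨_, lightVec_mem hx⟩ = 0 :=
    congrArg (fun f : BoundaryData Δ => f.1 ⟨_, lightVec_mem hx⟩) h
  simp [homogeneousExtension, lightVec_zero_apply] at h1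

end

end DeSitter

theorem mainTheorem1 (Δ : ℝ) :
    ¬ ∃ Ω : DeSitter.BoundaryData Δ →ₗ[ℝ] DeSitter.BoundaryData Δ →ₗ[ℝ] ℝ,
      DeSitter.IsSymplecticForm Ω ∧
      ∀ (g : DeSitter.SOPlus41) (f₁ f₂ : DeSitter.BoundaryData Δ),
        Ω (DeSitter.boundaryRep Δ g f₁) (DeSitter.boundaryRep Δ g f₂) = Ω f₁ f₂ := by
  rintro ⟨Ω, hΩ, hinv⟩
  exact DeSitter.ofSmooth_one_ne_zero Δ (hΩ.nondegenerate _ fun f =>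
    DeSitter.apply_eq_zero_of_invariant hΩ.continuous hΩ.antisymm hinv _ f)
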